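/- All groups are finite. For $k\ge 2$, $k$-dimensional Weisfeiler--Leman refinement starts from an initial coloring $\chi_0$ of the $k$-tuples over a finite set $V$ and iterates $$\chi_{r+1}(\bar v)=\bigl(\chi_r(\bar v),\ \{\!\!\{(\chi_r(\bar v(v_1/x)),\dots,\chi_r(\bar v(v_k/x))) : x\in V\}\!\!\}\bigr),$$ where $\bar v(v_i/x)$ is obtained from $\bar v$ by replacing the $i$-th entry by $x$, and $\{\!\!\{\cdot\}\!\!\}$ denotes a multiset. * Version I: $V=G$ is a group, and $\bar g\in G^k$, $\bar h\in H^k$ have the same initial color iff for all $i,j,\ell$: $g_ig_j=g_\ell\iff h_ih_j=h_\ell$, and $g_i=g_j\iff h_i=h_j$. * Version II: $V=G$ is a group, and $\bar g\in G^k$, $\bar h\in H^k$ have the same initial color iff $g_i\mapsto h_i$ extends to an isomorphism $\langle g_1,\dots,g_k\rangle\to\langle h_1,\dots,h_k\rangle$. * Version III: $V=V(\Gamma_G)$, where $\Gamma_G$ is the simple graph whose vertices are the elements of $G$ together with, for each $(g,h)\in G^2$, four new vertices $a_{gh},b_{gh},c_{gh},d_{gh}$, and whose edges are $\{g,a_{gh}\},\{h,b_{gh}\},\{gh,d_{gh}\},\{a_{gh},b_{gh}\},\{b_{gh},c_{gh}\},\{c_{gh},d_{gh}\}$.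 Two tuples $\bar u\in V(\Gamma_G)^k$, $\bar v\in V(\Gamma_H)^k$ have the same initial color iff for all $i,j$: $u_i=u_j\iff v_i=v_j$, and $u_i,u_j$ are adjacent iff $v_i,v_j$ are adjacent. For Versions I and II, we say that $(k,r)$-WL distinguishes $G$ and $H$ if the multisets $\{\!\!\{\chi_r(\bar g):\bar g\in G^k\}\!\!\}$ and $\{\!\!\{\chi_r(\bar h):\bar h\in H^k\}\!\!\}$ differ. For Version III there are two senses: in the graph sense one compares the multisets of the colors $\chi_r$ of all tuples in $V(\Gamma_G)^k$ and in $V(\Gamma_H)^k$; in the pulled-back sense one compares the multisets of the colors $\chi_r$ of the tuples in $G^k\subseteq V(\Gamma_G)^k$ and in $H^k\subseteq V(\Gamma_H)^k$. **Theorem.** There is an absolute constant $C$ such that the following holds for all $n$, all groups $G$ and $H$ of order $n$, and all integers $k\ge 2$, $r\ge 1$. (a) If $(k,r)$-WL Version I distinguishes $G$ and $H$, then $(k,r)$-WL Version II distinguishes $G$ and $H$. (b) If $(k,r)$-WL Version II distinguishes $G$ and $H$, then $(\lceil k/2\rceil+2,\ 3r+C\lfloor\log_2 n\rfloor)$-WL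 Version III distinguishes $G$ and $H$, in both senses. (c) If $(k,r)$-WL Version III distinguishes $G$ and $H$, in at least one of the two senses, then $(2k+1,2r)$-WL Version I distinguishes $G$ and $H$. -/

import Mathlib

universe u v w

namespace WLGroups

/-! ### The `k`-dimensional Weisfeiler--Leman refinement -/

/-- The set of colors available after `r` rounds of `k`-dimensional refinement, starting from a set
`C` of initial colors. -/
def Color (C : Type w) (k : ℕ) : ℕ → Type w
  | 0 => C
  | r + 1 => Color C k r × Multiset (Fin k → Color C k r)

/-- The coloring `χ_r` of the `k`-tuples after `r` rounds, starting from the initial coloring `χ₀`: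
`χ_{r+1}(v) = (χ_r(v), {{ (χ_r(v(v₁/x)), …, χ_r(v(v_k/x))) | x }})`. -/
def coloring {V : Type v} [Fintype V] {C : Type w} {k : ℕ} (χ₀ : (Fin k → V) → C) :
    (r : ℕ) → (Fin k → V) → Color C k r
  | 0, t => χ₀ t
  | r + 1, t =>
      (coloring χ₀ r t,
        (Finset.univ : Finset V).val.map
          (fun x => fun i : Fin k => coloring χ₀ r (Function.update t i x)))

/-- The multiset of the values of a function on a finite type. -/
def valueMultiset {T : Type v} [Fintype T] {D : Type w} (χ : T → D) : Multiset D :=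
  (Finset.univ : Finset T).val.map χ

/-! ### Version I -/

/-- The initial color of Version I records which products `gᵢ gⱼ = g_l` and which equalities
`gᵢ = gⱼ` hold. -/
def initI (G : Type u) [Group G] (k : ℕ) (g : Fin k → G) :
    (Fin k → Fin k → Fin k → Prop) × (Fin k → Fin k → Prop) :=
  (fun i j l => g i * g j = g l, fun i j => g i = g j)

/-- `(k, r)`-WL Version I distinguishes `G` and `H`: after `r` rounds the multisets of colors of
the `k`-tuples of group elements differ. -/
def DistinguishesI (k r : ℕ) (G H : Type u) [Group G] [Fintype G] [Group H] [Fintype H] : Prop :=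
  valueMultiset (coloring (initI G k) r) ≠ valueMultiset (coloring (initI H k) r)

/-! ### Version II -/

/-- A group together with a `k`-tuple of its elements. -/
structure MarkedGroup (k : ℕ) : Type (u + 1) where
  carrier : Type u
  [group : Group carrier]
  tuple : Fin k → carrier

attribute [instance] MarkedGroup.group

/-- The map `gᵢ ↦ hᵢ` extends to an isomorphism `⟨g₁, …, g_k⟩ ≃ ⟨h₁, …, h_k⟩`. -/
def MarkedIso {k : ℕ} {G H : Type u} [Group G] [Group H] (g : Fin k → G) (h : Fin k → H) : Prop :=
  ∃ φ : Subgroup.closure (Set.range g) ≃* Subgroup.closure (Set.range h),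
    ∀ i, φ ⟨g i, Subgroup.subset_closure ⟨i, rfl⟩⟩ = ⟨h i, Subgroup.subset_closure ⟨i, rfl⟩⟩

/-- The relation `MarkedIso` as an equivalence relation on marked groups. -/
def markedSetoid (k : ℕ) : Setoid (MarkedGroup.{u} k) where
  r M N := MarkedIso M.tuple N.tuple
  iseqv :=
    { refl := fun _ => ⟨MulEquiv.refl _, fun _ => rfl⟩
      symm := fun ⟨φ, hφ⟩ => ⟨φ.symm, fun i => by rw [← hφ i, MulEquiv.symm_apply_apply]⟩
      trans := fun ⟨φ, hφ⟩ ⟨ψ, hψ⟩ =>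
        ⟨φ.trans ψ, fun i => by rw [MulEquiv.trans_apply, hφ i, hψ i]⟩ }

/-- The initial color of Version II is the marked isomorphism type of the tuple, so that two tuples
(of possibly different groups) have the same initial color iff they are related by `MarkedIso`. -/
def initII (G : Type u) [Group G] (k : ℕ) (g : Fin k → G) : Quotient (markedSetoid.{u} k) :=
  Quotient.mk (markedSetoid k) ⟨G, g⟩

/-- `(k, r)`-WL Version II distinguishes `G` and `H`. -/
def DistinguishesII (k r : ℕ) (G H : Type u) [Group G] [Fintype G] [Group H] [Fintype H] : Prop :=
  valueMultiset (coloring (initII G k) r) ≠ valueMultiset (coloring (initII H k) r)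

/-! ### Version III -/

/-- The four kinds of vertices of a multiplication gadget that are not group elements. -/
inductive GadgetKind : Type
  | a | b | c | d
  deriving DecidableEq

instance : Fintype GadgetKind := ⟨{.a, .b, .c, .d}, fun x => by cases x <;> decide⟩

/-- The vertices of `Γ_G`: the group elements, and for every pair `(g, h)` the four vertices
`a, b, c, d` of the multiplication gadget `M(g, h)`. -/
abbrev GadgetVertex (G : Type u) : Type u := G ⊕ ((G × G) × GadgetKind)

/-- The edges of the gadgets `M(g, h)`, each listed in one direction: the path `a - b - c - d`,
with `g` attached to `a`, with `h` attached to `b`, and with `g * h` attached to `d`. -/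
inductive GadgetEdge (G : Type u) [Group G] : GadgetVertex G → GadgetVertex G → Prop
  | left (g h : G) : GadgetEdge G (.inl g) (.inr ((g, h), .a))
  | right (g h : G) : GadgetEdge G (.inl h) (.inr ((g, h), .b))
  | prod (g h : G) : GadgetEdge G (.inl (g * h)) (.inr ((g, h), .d))
  | ab (g h : G) : GadgetEdge G (.inr ((g, h), .a)) (.inr ((g, h), .b))
  | bc (g h : G) : GadgetEdge G (.inr ((g, h), .b)) (.inr ((g, h), .c))
  | cd (g h : G) : GadgetEdge G (.inr ((g, h), .c)) (.inr ((g, h), .d))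

/-- The simple graph `Γ_G` built from the Cayley table of `G`. -/
def cayleyGraph (G : Type u) [Group G] : SimpleGraph (GadgetVertex G) :=
  SimpleGraph.fromRel (GadgetEdge G)

/-- The initial color of `k`-WL for graphs: it records which entries of the tuple are adjacent and
which are equal, that is, the isomorphism type of the induced subgraph with its labelling. -/
def initGraph {V : Type v} (Γ : SimpleGraph V) (k : ℕ) (t : Fin k → V) :
    (Fin k → Fin k → Prop) × (Fin k → Fin k → Prop) :=
  (fun i j => Γ.Adj (t i) (t j), fun i j => t i = t j)

/-- The coloring of Version III on `k`-tuples of vertices of `Γ_G`. -/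
def coloringIII (G : Type u) [Group G] [Fintype G] (k r : ℕ) (t : Fin k → GadgetVertex G) :
    Color ((Fin k → Fin k → Prop) × (Fin k → Fin k → Prop)) k r :=
  coloring (initGraph (cayleyGraph G) k) r t

/-- `(k, r)`-WL Version III distinguishes `G` and `H`, comparing the multisets of colors of the
`k`-tuples of vertices of `Γ_G` and `Γ_H`. -/
def DistinguishesIII (k r : ℕ) (G H : Type u) [Group G] [Fintype G] [Group H] [Fintype H] : Prop :=
  valueMultiset (coloringIII G k r) ≠ valueMultiset (coloringIII H k r)

/-- `(k, r)`-WL Version III distinguishes `G` and `H`, comparing the multisets of colors of the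
`k`-tuples of group elements under the coloring pulled back from the graphs. -/
def DistinguishesIIIPullback (k r : ℕ) (G H : Type u)
    [Group G] [Fintype G] [Group H] [Fintype H] : Prop :=
  valueMultiset (fun g : Fin k → G => coloringIII G k r (fun i => .inl (g i))) ≠
    valueMultiset (fun h : Fin k → H => coloringIII H k r (fun i => .inl (h i)))

end WLGroups

/-! Two tuples have equal colors after `r` rounds iff Duplicator survives `r` rounds of the
bijective pebble game from them (`coloring_eq_iff`). Each part is then a comparison of games.

(a) A marked isomorphism preserves all products and equalities among the entries, so the safe
positions of Version II are safe in Version I.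

(c) A vertex of `Γ_G` is a kind together with a pair of group elements, and adjacency is a statement
about equalities and single products of these elements. So `2k` pebbles on the group code `k`
pebbles on the graph, and with one spare pebble two group rounds simulate one graph round
(`gameEquiv_decode`).

(b) Conversely, a pebble on a vertex of kind `c` stores two group elements, so `⌈k/2⌉` such pebbles
hold a `k`-tuple. Boundedly many rounds recognize the kinds and read off both factors and the
product of a gadget. By repeated halving, Spoiler with two spare pebbles verifies products of length
`|G × H|` in `O(log n)` rounds, so Duplicator must maintain a marked isomorphism
(`Stored.fst_eq_one_iff`), and two graph rounds simulate one round of Version II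
(`gameEquiv_tupleIso`). It remains to pass from one surviving position to all `k`-tuples. For `k ≤
log₂ n` this costs `k` more rounds of Version II. For larger `k` the pebbles can hold a generating
set, and survival forces `G ≃* H`. -/

namespace WLGroups

/-! ### The bijective pebble game -/

section Game

variable {ι κ V W : Type*}

/-- Duplicator survives `r` rounds of the bijective pebble game from the position `(s, t)`, where a
position counts as safe if it satisfies `S`. -/
def GameEquiv [DecidableEq ι] (S : (ι → V) → (ι → W) → Prop) :
    ℕ → (ι → V) → (ι → W) → Prop
  | 0, s, t => S s t
  | r + 1, s, t => GameEquiv S r s t ∧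
      ∃ f : V ≃ W, ∀ x i, GameEquiv S r (Function.update s i x) (Function.update t i (f x))

namespace GameEquiv

variable [DecidableEq ι] [DecidableEq κ] {S : (ι → V) → (ι → W) → Prop} {s : ι → V} {t : ι → W}

theorem of_le {q r : ℕ} (hqr : q ≤ r) (h : GameEquiv S r s t) : GameEquiv S q s t := by
  induction hqr with
  | refl => exact h
  | step _ ih => exact ih h.1

theorem safe {r : ℕ} (h : GameEquiv S r s t) : S s t :=
  h.of_le (Nat.zero_le r)

theorem mono {S' : (ι → V) → (ι → W) → Prop} (hS : ∀ s t, S s t → S' s t) {r : ℕ}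
    (h : GameEquiv S r s t) : GameEquiv S' r s t := by
  induction r generalizing s t with
  | zero => exact hS _ _ h
  | succ r ih =>
    obtain ⟨h₁, f, hf⟩ := h
    exact ⟨ih h₁, f, fun x i => ih (hf x i)⟩

theorem comp_injective {S' : (κ → V) → (κ → W) → Prop} (e : κ → ι) (he : Function.Injective e)
    (hS : ∀ s t, S s t → S' (s ∘ e) (t ∘ e)) {r : ℕ} (h : GameEquiv S r s t) :
    GameEquiv S' r (s ∘ e) (t ∘ e) := by
  induction r generalizing s t with
  | zero => exact hS _ _ h
  | succ r ih =>
    obtain ⟨h₁, f, hf⟩ := h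
    refine ⟨ih h₁, f, fun x i => ?_⟩
    have := ih (hf x (e i))
    rwa [Function.update_comp_eq_of_injective _ he, Function.update_comp_eq_of_injective _ he]
      at this

/-- Pebbles can be placed on prescribed vertices, one round for each. -/
theorem exists_piecewise (u : ι → V) (B : Finset ι) {r : ℕ} (h : GameEquiv S (r + B.card) s t) :
    ∃ t', GameEquiv S r (B.piecewise u s) t' := by
  induction B using Finset.induction_on generalizing r with
  | empty => exact ⟨t, by simpa using h⟩
  | insert a B ha ih =>
    rw [Finset.card_insert_of_notMem ha, ← add_assoc, add_right_comm] at h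
    obtain ⟨t', -, f, hf⟩ := ih h
    exact ⟨_, by simpa only [Finset.piecewise_insert] using hf (u a) a⟩

/-- Playing on the coordinates in `B` one after another, Duplicator answers every choice of the
vertices injectively. -/
theorem exists_injective_on (B : Finset ι) {r : ℕ} (h : GameEquiv S (r + B.card) s t) :
    ∃ E : (ι → V) → (ι → W), (∀ u, GameEquiv S r (B.piecewise u s) (E u)) ∧
      ∀ u u', (∀ i ∈ B, E u i = E u' i) → ∀ i ∈ B, u i = u' i := by
  induction B using Finset.induction_on generalizing r with
  | empty => exact ⟨fun _ => t, fun u => by simpa using h, by simp⟩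
  | insert a B ha ih =>
    rw [Finset.card_insert_of_notMem ha, ← add_assoc, add_right_comm] at h
    obtain ⟨E, hE, hinj⟩ := ih h
    choose _ f hf using hE
    -- Feeding `B.piecewise u s` to `E` makes the earlier answers depend only on `u` over `B`.
    -- Tuples agreeing on `B` therefore meet the same bijection at `a`, which gives injectivity.
    refine ⟨fun u => Function.update (E (B.piecewise u s)) a (f (B.piecewise u s) (u a)),
      fun u => ?_, fun u u' hu => ?_⟩
    · have := hf (B.piecewise u s) (u a) a
      rw [Finset.piecewise_insert]
      have hB : B.piecewise (B.piecewise u s) s = B.piecewise u s := by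
        ext i
        by_cases i ∈ B <;> simp [*]
      rwa [hB] at this
    · have hB : ∀ i ∈ B, u i = u' i := by
        intro i hi
        have := hinj (B.piecewise u s) (B.piecewise u' s) (fun j hj => ?_) i hi
        · simpa [hi] using this
        · have hja : j ≠ a := fun h => ha (h ▸ hj)
          simpa [hja] using hu j (Finset.mem_insert_of_mem hj)
      have hp : B.piecewise u s = B.piecewise u' s :=
        Finset.piecewise_congr B hB fun _ _ => rfl
      intro i hi
      obtain rfl | hi := Finset.mem_insert.1 hi
      · simpa [hp] using hu i (Finset.mem_insert_self _ _)
      · exact hB i hi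

end GameEquiv

theorem exists_equiv_of_map_univ_eq {T T' D : Type*} [Fintype T] [Fintype T'] {χ : T → D}
    {χ' : T' → D} (h : (Finset.univ : Finset T).val.map χ = (Finset.univ : Finset T').val.map χ') :
    ∃ E : T ≃ T', ∀ x, χ x = χ' (E x) := by
  classical
  have hc (d : D) : Nonempty ({x // χ x = d} ≃ {x // χ' x = d}) := by
    rw [← Fintype.card_eq, Fintype.card_subtype, Fintype.card_subtype]
    have := congrArg (Multiset.count d) h
    rw [Multiset.count_map, Multiset.count_map] at this
    simpa only [eq_comm, ← Finset.filter_val, Finset.card_val] using this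
  let e (d : D) : {x // χ x = d} ≃ {x // χ' x = d} := (hc d).some
  refine ⟨(Equiv.sigmaFiberEquiv χ).symm.trans
    ((Equiv.sigmaCongrRight fun d => (e d)).trans (Equiv.sigmaFiberEquiv χ')), fun x => ?_⟩
  exact ((e (χ x)) ⟨x, rfl⟩).2.symm

theorem map_univ_eq_of_equiv {T T' D : Type*} [Fintype T] [Fintype T'] {χ : T → D}
    {χ' : T' → D} (E : T ≃ T') (h : ∀ x, χ x = χ' (E x)) :
    (Finset.univ : Finset T).val.map χ = (Finset.univ : Finset T').val.map χ' := by
  classical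
  rw [← Finset.map_univ_equiv E, Finset.map_val, Multiset.map_map]
  exact Multiset.map_congr rfl fun x _ => h x

theorem map_univ_eq_of_injective {T T' D : Type*} [Fintype T] [Fintype T'] {χ : T → D}
    {χ' : T' → D} (hc : Fintype.card T = Fintype.card T') (E : T → T')
    (hE : Function.Injective E) (h : ∀ x, χ x = χ' (E x)) :
    (Finset.univ : Finset T).val.map χ = (Finset.univ : Finset T').val.map χ' :=
  map_univ_eq_of_equiv
    (Equiv.ofBijective E ((Fintype.bijective_iff_injective_and_card E).2 ⟨hE, hc⟩)) h

end Game

/-- Equality of the two multisets is a bijection matching all `k` replacement colors at once, that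
is, a move of Duplicator made before the coordinate `i` is chosen. -/
theorem coloring_eq_iff {V W : Type v} [Fintype V] [Fintype W] {C : Type w} {k : ℕ}
    {χ : (Fin k → V) → C} {χ' : (Fin k → W) → C} {r : ℕ} {s : Fin k → V} {t : Fin k → W} :
    coloring χ r s = coloring χ' r t ↔ GameEquiv (fun s t => χ s = χ' t) r s t := by
  induction r generalizing s t with
  | zero => rfl
  | succ r ih =>
    simp only [coloring, GameEquiv, ← ih]
    refine Prod.mk.injEq _ _ _ _ ▸ and_congr_right fun _ => ⟨fun h => ?_, fun ⟨f, hf⟩ => ?_⟩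
    · obtain ⟨f, hf⟩ := exists_equiv_of_map_univ_eq h
      exact ⟨f, fun x i => congrFun (hf x) i⟩
    · exact map_univ_eq_of_equiv f fun x => funext fun i => hf x i

/-- One surviving position suffices: `k` rounds replace every entry, Duplicator's answers are
injective in the chosen tuple, and an injection between finite sets of equal size is bijective. -/
theorem valueMultiset_coloring_eq_of_gameEquiv {V W : Type v} [Fintype V] [Fintype W]
    (hc : Fintype.card V = Fintype.card W) {C : Type w} {k : ℕ}
    {χ : (Fin k → V) → C} {χ' : (Fin k → W) → C} {r : ℕ} {s : Fin k → V} {t : Fin k → W}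
    (h : GameEquiv (fun s t => χ s = χ' t) (r + k) s t) :
    valueMultiset (coloring χ r) = valueMultiset (coloring χ' r) := by
  obtain ⟨E, hE, hinj⟩ := GameEquiv.exists_injective_on (S := fun s t => χ s = χ' t) (r := r)
    (s := s) (t := t) Finset.univ (by rwa [Finset.card_univ, Fintype.card_fin])
  refine map_univ_eq_of_injective (by simp [hc]) E (fun u u' huu' => ?_) fun u => ?_
  · exact funext fun i => hinj u u' (fun j _ => congrFun huu' j) i (Finset.mem_univ i)
  · simpa using coloring_eq_iff.2 (hE u)

/-! ### The edges of `Γ_G` -/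

section Edges

variable {G : Type*} [Group G]

theorem gadgetEdge_inl_inl (x y : G) : ¬ GadgetEdge G (.inl x) (.inl y) := by
  rintro ⟨⟩

theorem gadgetEdge_inr_inl (p : (G × G) × GadgetKind) (y : G) :
    ¬ GadgetEdge G (.inr p) (.inl y) := by
  rintro ⟨⟩

theorem gadgetEdge_inl_inr (x : G) (p : G × G) (κ : GadgetKind) :
    GadgetEdge G (.inl x) (.inr (p, κ)) ↔
      κ = .a ∧ p.1 = x ∨ κ = .b ∧ p.2 = x ∨ κ = .d ∧ p.1 * p.2 = x := by
  obtain ⟨g, h⟩ := p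
  constructor
  · rintro ⟨⟩ <;> simp
  · rintro (⟨rfl, rfl⟩ | ⟨rfl, rfl⟩ | ⟨rfl, rfl⟩)
    exacts [.left g h, .right g h, .prod g h]

theorem gadgetEdge_inr_inr (p q : G × G) (κ μ : GadgetKind) :
    GadgetEdge G (.inr (p, κ)) (.inr (q, μ)) ↔
      p = q ∧ (κ = .a ∧ μ = .b ∨ κ = .b ∧ μ = .c ∨ κ = .c ∧ μ = .d) := by
  obtain ⟨g, h⟩ := p
  constructor
  · rintro ⟨⟩ <;> simp
  · rintro ⟨rfl, ⟨rfl, rfl⟩ | ⟨rfl, rfl⟩ | ⟨rfl, rfl⟩⟩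
    exacts [.ab g h, .bc g h, .cd g h]

theorem adj_inl_inl (x y : G) : ¬ (cayleyGraph G).Adj (.inl x) (.inl y) := by
  simp [cayleyGraph, gadgetEdge_inl_inl]

theorem adj_inl_inr (x : G) (p : G × G) (κ : GadgetKind) :
    (cayleyGraph G).Adj (.inl x) (.inr (p, κ)) ↔
      κ = .a ∧ p.1 = x ∨ κ = .b ∧ p.2 = x ∨ κ = .d ∧ p.1 * p.2 = x := by
  simp [cayleyGraph, gadgetEdge_inl_inr, gadgetEdge_inr_inl]

theorem adj_inr_inl (x : G) (p : G × G) (κ : GadgetKind) :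
    (cayleyGraph G).Adj (.inr (p, κ)) (.inl x) ↔
      κ = .a ∧ p.1 = x ∨ κ = .b ∧ p.2 = x ∨ κ = .d ∧ p.1 * p.2 = x := by
  rw [SimpleGraph.adj_comm, adj_inl_inr]

theorem adj_inr_inr (p q : G × G) (κ μ : GadgetKind) :
    (cayleyGraph G).Adj (.inr (p, κ)) (.inr (q, μ)) ↔
      p = q ∧ (κ = .a ∧ μ = .b ∨ κ = .b ∧ μ = .c ∨ κ = .c ∧ μ = .d ∨
        κ = .b ∧ μ = .a ∨ κ = .c ∧ μ = .b ∨ κ = .d ∧ μ = .c) := by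
  simp only [cayleyGraph, SimpleGraph.fromRel_adj, gadgetEdge_inr_inr, ne_eq, Sum.inr.injEq,
    Prod.mk.injEq]
  by_cases h : p = q <;> cases κ <;> cases μ <;> simp [h, eq_comm]

end Edges

/-! ### Safe positions -/

/-- Equal initial colors of Version I. -/
def MultiplicationEquiv {ι G H : Type*} [Group G] [Group H] (s : ι → G) (t : ι → H) : Prop :=
  (∀ i j l, s i * s j = s l ↔ t i * t j = t l) ∧ ∀ i j, s i = s j ↔ t i = t j

/-- Equal initial colors for graphs. -/
def GraphEquiv {ι V W : Type*} (Γ : SimpleGraph V) (Δ : SimpleGraph W) (s : ι → V) (t : ι → W) :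
    Prop :=
  ∀ i j, (Γ.Adj (s i) (s j) ↔ Δ.Adj (t i) (t j)) ∧ (s i = s j ↔ t i = t j)

theorem initI_eq_iff {G H : Type u} [Group G] [Group H] {k : ℕ} {s : Fin k → G} {t : Fin k → H} :
    initI G k s = initI H k t ↔ MultiplicationEquiv s t := by
  simp [initI, MultiplicationEquiv, funext_iff]

theorem initII_eq_iff {G H : Type u} [Group G] [Group H] {k : ℕ} {s : Fin k → G} {t : Fin k → H} :
    initII G k s = initII H k t ↔ MarkedIso s t :=
  Quotient.eq

theorem initGraph_eq_iff {V W : Type v} {Γ : SimpleGraph V} {Δ : SimpleGraph W} {k : ℕ}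
    {s : Fin k → V} {t : Fin k → W} :
    initGraph Γ k s = initGraph Δ k t ↔ GraphEquiv Γ Δ s t := by
  simp [initGraph, GraphEquiv, funext_iff, forall_and]

theorem MarkedIso.multiplicationEquiv {k : ℕ} {G H : Type u} [Group G] [Group H] {s : Fin k → G}
    {t : Fin k → H} (h : MarkedIso s t) : MultiplicationEquiv s t := by
  obtain ⟨φ, hφ⟩ := h
  refine ⟨fun i j l => ?_, fun i j => ?_⟩
  · have := (φ.injective.eq_iff (a := ⟨s i, Subgroup.subset_closure ⟨i, rfl⟩⟩ *
      ⟨s j, Subgroup.subset_closure ⟨j, rfl⟩⟩) (b := ⟨s l, Subgroup.subset_closure ⟨l, rfl⟩⟩)).symm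
    simpa only [map_mul, hφ, Subtype.ext_iff, Subgroup.coe_mul] using this
  · have := (φ.injective.eq_iff (a := ⟨s i, Subgroup.subset_closure ⟨i, rfl⟩⟩)
      (b := ⟨s j, Subgroup.subset_closure ⟨j, rfl⟩⟩)).symm
    simpa only [hφ, Subtype.ext_iff] using this

theorem DistinguishesI.distinguishesII {k r : ℕ} {G H : Type u} [Group G] [Fintype G] [Group H]
    [Fintype H] (h : DistinguishesI k r G H) : DistinguishesII k r G H := by
  refine fun h' => h ?_
  obtain ⟨E, hE⟩ := exists_equiv_of_map_univ_eq h'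
  refine map_univ_eq_of_equiv E fun s => coloring_eq_iff.2 ((coloring_eq_iff.1 (hE s)).mono ?_)
  exact fun s t h => initI_eq_iff.2 (initII_eq_iff.1 h).multiplicationEquiv

/-! ### Version III is simulated by Version I -/

section Simulation

variable {ι : Type*} {G H : Type*}

/-- The vertices coded by pairs of group elements. A vertex without a kind is a group element, and
is coded by the first entry of its pair. -/
def decode (κ : ι → Option GadgetKind) (s : Option (ι × Bool) → G) (i : ι) : GadgetVertex G :=
  match κ i with
  | none => .inl (s (some (i, false)))
  | some μ => .inr ((s (some (i, false)), s (some (i, true))), μ)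

/-- The kind of a vertex of `Γ_G`, with the value `none` for the group elements. -/
def vertexKind : GadgetVertex G → Option GadgetKind
  | .inl _ => none
  | .inr (_, μ) => some μ

/-- The pair of group elements which codes a vertex. -/
def vertexPair : GadgetVertex G → Bool → G
  | .inl g, _ => g
  | .inr ((g, _), _), false => g
  | .inr ((_, h), _), true => h

/-- The code of a tuple of vertices, with the superfluous entry taken from the vertex at `o`. -/
def encode (o : ι) (t : ι → GadgetVertex G) : Option (ι × Bool) → G
  | none => vertexPair (t o) false
  | some (i, b) => vertexPair (t i) b

theorem decode_encode (o : ι) (t : ι → GadgetVertex G) :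
    decode (fun i => vertexKind (t i)) (encode o t) = t := by
  funext i
  rcases h : t i with g | ⟨⟨g, g'⟩, μ⟩ <;> simp [decode, encode, vertexKind, vertexPair, h]

theorem vertexKind_decode (κ : ι → Option GadgetKind) (s : Option (ι × Bool) → G) (i : ι) :
    vertexKind (decode κ s i) = κ i := by
  unfold decode
  split <;> simp_all [vertexKind]

theorem encode_decode (o : ι) (κ : ι → Option GadgetKind) (s : Option (ι × Bool) → G)
    (ho : s none = s (some (o, false)))
    (hs : ∀ i, κ i = none → s (some (i, true)) = s (some (i, false))) :
    encode o (decode κ s) = s := by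
  funext j
  rcases j with _ | ⟨i, _ | _⟩ <;> simp only [encode, decode]
  · split <;> simp [vertexPair, ho]
  · split <;> simp [vertexPair]
  · split <;> simp_all [vertexPair]

variable [Group G] [Group H]

theorem MultiplicationEquiv.graphEquiv_decode {s : Option (ι × Bool) → G}
    {t : Option (ι × Bool) → H} (h : MultiplicationEquiv s t) (κ : ι → Option GadgetKind) :
    GraphEquiv (cayleyGraph G) (cayleyGraph H) (decode κ s) (decode κ t) := by
  intro i j
  unfold decode
  rcases κ i with _ | μ <;> rcases κ j with _ | μ' <;>
    simp [adj_inl_inl, adj_inl_inr, adj_inr_inl, adj_inr_inr, h.1, h.2]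

theorem gameEquiv_decode [DecidableEq ι] {r : ℕ} {s : Option (ι × Bool) → G}
    {t : Option (ι × Bool) → H} (h : GameEquiv MultiplicationEquiv (2 * r) s t)
    (κ : ι → Option GadgetKind) :
    GameEquiv (GraphEquiv (cayleyGraph G) (cayleyGraph H)) r (decode κ s) (decode κ t) := by
  induction r generalizing s t κ with
  | zero => exact MultiplicationEquiv.graphEquiv_decode h κ
  | succ r ih =>
    refine ⟨ih (h.of_le (by lia)) κ, ?_⟩
    obtain ⟨-, φ, hφ⟩ := h
    choose _ ψ hψ using fun x => hφ x none
    -- `ψ x` is Duplicator's bijection once `x` occupies the spare pebble; gadget vertices go by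
    -- `(x, y) ↦ (φ x, ψ x y)` with their kind kept.
    refine ⟨Equiv.sumCongr φ (Equiv.prodCongr (Equiv.prodShear φ ψ) (Equiv.refl _)), ?_⟩
    rintro (x | ⟨⟨x, y⟩, μ⟩) i
    · convert ih ((hφ x (some (i, false))).of_le (Nat.le_succ _)) (Function.update κ i none)
        using 1 <;>
      · funext j
        by_cases hj : j = i
        · subst hj; simp [decode]
        · simp [decode, hj]
    -- The first factor sits on the spare pebble, so the swap moves it into place. The displaced
    -- entry becomes the spare one, which `decode` ignores.
    · have := (hψ x y (some (i, true))).comp_injective (S' := MultiplicationEquiv)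
        (Equiv.swap none (some (i, false))) (Equiv.injective _)
        fun s t h => ⟨fun _ _ _ => h.1 _ _ _, fun _ _ => h.2 _ _⟩
      convert ih this (Function.update κ i (some μ)) using 1 <;>
      · funext j
        by_cases hj : j = i
        · subst hj
          simp [decode, Equiv.swap_apply_def]
        · simp [decode, Equiv.swap_apply_def, hj]

end Simulation

theorem not_distinguishesIII_of_not_distinguishesI {k r : ℕ} {G H : Type u} [Group G] [Fintype G]
    [Group H] [Fintype H] (hGH : Fintype.card G = Fintype.card H) (hk : 2 ≤ k)
    (h : ¬ DistinguishesI (2 * k + 1) (2 * r) G H) :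
    ¬ DistinguishesIII k r G H ∧ ¬ DistinguishesIIIPullback k r G H := by
  obtain ⟨E, hE⟩ := exists_equiv_of_map_univ_eq (not_not.1 h)
  simp only [coloring_eq_iff, initI_eq_iff] at hE
  let e : Option (Fin k × Bool) ≃ Fin (2 * k + 1) :=
    Fintype.equivFinOfCardEq (by simp [mul_comm])
  let F (s : Option (Fin k × Bool) → G) : Option (Fin k × Bool) → H := E (s ∘ e.symm) ∘ e
  have hFinj : Function.Injective F := fun s s' hs =>
    e.symm.surjective.injective_comp_right (E.injective (e.surjective.injective_comp_right hs))
  have hF (s) : GameEquiv MultiplicationEquiv (2 * r) s (F s) := by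
    have := (hE (s ∘ e.symm)).comp_injective (S' := MultiplicationEquiv) e e.injective
        fun s t h => ⟨fun _ _ _ => h.1 _ _ _, fun _ _ => h.2 _ _⟩
    simpa [Function.comp_assoc] using this
  let o : Fin k := ⟨0, by lia⟩
  let M (t : Fin k → GadgetVertex G) : Fin k → GadgetVertex H :=
    decode (fun i => vertexKind (t i)) (F (encode o t))
  have hM (t) : coloringIII G k r t = coloringIII H k r (M t) := by
    refine coloring_eq_iff.2 (GameEquiv.mono (fun s t => initGraph_eq_iff.2) ?_)
    simpa [decode_encode] using gameEquiv_decode (hF (encode o t)) fun i => vertexKind (t i)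
  have hkind (t i) : vertexKind (M t i) = vertexKind (t i) := vertexKind_decode _ _ i
  -- Equalities between entries are preserved, so the answer to a code is again a code; thus `M`
  -- inherits injectivity from `F`.
  have hcode (t) : encode o (M t) = F (encode o t) := by
    have hs := (hF (encode o t)).safe
    refine encode_decode _ _ _ ((hs.2 _ _).1 rfl) fun i hi => (hs.2 _ _).1 ?_
    rcases hti : t i with g | ⟨⟨g, g'⟩, μ⟩ <;> simp_all [encode, vertexKind, vertexPair]
  have hMinj : Function.Injective M := by
    intro t t' htt'
    have hc : encode o t = encode o t' := hFinj (by rw [← hcode, ← hcode, htt'])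
    rw [← decode_encode o t, ← decode_encode o t', hc]
    congr 1
    funext i
    rw [← hkind, ← hkind, htt']
  refine ⟨not_not.2 (map_univ_eq_of_injective (by simp [hGH]) M hMinj hM), not_not.2 ?_⟩
  let N (g : Fin k → G) : Fin k → H := fun i => F (encode o fun i => .inl (g i)) (some (i, false))
  have hN (g : Fin k → G) : M (fun i => .inl (g i)) = fun i => .inl (N g i) := rfl
  refine map_univ_eq_of_injective (by simp [hGH]) N (fun g g' hgg' => ?_) fun g => ?_
  · have := hMinj ((hN g).trans ((hgg' ▸ rfl : _ = _).trans (hN g').symm))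
    exact funext fun i => Sum.inl_injective (congrFun this i)
  · rw [hM, hN]

/-! ### Properties of vertices that Spoiler can check in boundedly many rounds -/

section Detected

variable (ι : Type*) [DecidableEq ι] {V W : Type*} (Γ : SimpleGraph V) (Δ : SimpleGraph W)

/-- The relations `P` and `Q` correspond in all positions from which Duplicator survives `c`
rounds. -/
def Detected (c : ℕ) (P : V → V → Prop) (Q : W → W → Prop) : Prop :=
  ∀ (s : ι → V) (t : ι → W), GameEquiv (GraphEquiv Γ Δ) c s t →
    ∀ i j, P (s i) (s j) ↔ Q (t i) (t j)

variable {ι Γ Δ} {c : ℕ} {P P' : V → V → Prop} {Q Q' : W → W → Prop}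

namespace Detected

theorem adj : Detected ι Γ Δ 0 Γ.Adj Δ.Adj := fun _ _ h i j => (h i j).1

theorem of_le {c' : ℕ} (hc : c ≤ c') (h : Detected ι Γ Δ c P Q) : Detected ι Γ Δ c' P Q :=
  fun s t hst => h s t (hst.of_le hc)

theorem not (h : Detected ι Γ Δ c P Q) :
    Detected ι Γ Δ c (fun x y => ¬ P x y) (fun x y => ¬ Q x y) :=
  fun s t hst i j => not_congr (h s t hst i j)

theorem and (h : Detected ι Γ Δ c P Q) (h' : Detected ι Γ Δ c P' Q') :
    Detected ι Γ Δ c (fun x y => P x y ∧ P' x y) (fun x y => Q x y ∧ Q' x y) :=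
  fun s t hst i j => and_congr (h s t hst i j) (h' s t hst i j)

/-- Spoiler places the witness `z` on a third pebble, at the price of one round. -/
theorem comp (hι : ∀ i j : ι, ∃ l, l ≠ i ∧ l ≠ j) (h : Detected ι Γ Δ c P Q)
    (h' : Detected ι Γ Δ c P' Q') :
    Detected ι Γ Δ (c + 1) (fun x y => ∃ z, P x z ∧ P' z y) (fun x y => ∃ z, Q x z ∧ Q' z y) := by
  intro s t ⟨_, f, hf⟩ i j
  obtain ⟨l, hi, hj⟩ := hι i j
  refine (exists_congr fun z => ?_).trans
    (f.exists_congr_right (q := fun z => Q (t i) z ∧ Q' z (t j)))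
  have h₁ := h _ _ (hf z l) i l
  have h₂ := h' _ _ (hf z l) l j
  simp only [Function.update_self, Function.update_of_ne hi.symm, Function.update_of_ne hj.symm]
    at h₁ h₂
  exact and_congr h₁ h₂

end Detected

/-- A vertex with at least four neighbors. -/
def IsHub (Γ : SimpleGraph V) (x : V) : Prop :=
  4 ≤ (Γ.neighborSet x).ncard

/-- In `Γ_G`, the vertices of kind `c`. -/
def IsC (Γ : SimpleGraph V) (x : V) : Prop :=
  ¬ IsHub Γ x ∧ ¬ ∃ z, Γ.Adj x z ∧ IsHub Γ z

/-- In `Γ_G`, the vertices of kind `a`. -/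
def IsA (Γ : SimpleGraph V) (x : V) : Prop :=
  ¬ IsHub Γ x ∧ ¬ IsC Γ x ∧ ¬ ∃ z, Γ.Adj x z ∧ IsC Γ z

/-- In `Γ_G`, the vertices of kind `b`. -/
def IsB (Γ : SimpleGraph V) (x : V) : Prop :=
  ¬ IsHub Γ x ∧ ∃ z, Γ.Adj x z ∧ IsA Γ z

/-- In `Γ_G`, the vertices of kind `d`. -/
def IsD (Γ : SimpleGraph V) (x : V) : Prop :=
  ¬ IsHub Γ x ∧ ¬ IsA Γ x ∧ ¬ IsB Γ x ∧ ¬ IsC Γ x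

/-- In `Γ_G`, for `x = c_{gh}` this is the relation `y = g`. -/
def IsLeft (Γ : SimpleGraph V) (x y : V) : Prop :=
  ∃ b, Γ.Adj x b ∧ IsB Γ b ∧ ∃ a, Γ.Adj b a ∧ IsA Γ a ∧ Γ.Adj a y

/-- In `Γ_G`, for `x = c_{gh}` this is the relation `y = h`. -/
def IsRight (Γ : SimpleGraph V) (x y : V) : Prop :=
  ∃ b, Γ.Adj x b ∧ IsB Γ b ∧ Γ.Adj b y

/-- In `Γ_G`, for `x = c_{gh}` this is the relation `y = g * h`. -/
def IsProd (Γ : SimpleGraph V) (x y : V) : Prop :=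
  ∃ d, Γ.Adj x d ∧ IsD Γ d ∧ Γ.Adj d y

/-- Duplicator's bijection must carry neighbors onto neighbors, so degrees agree after a single
round. -/
theorem detected_isHub (hι : ∀ i j : ι, ∃ l, l ≠ i ∧ l ≠ j) :
    Detected ι Γ Δ 1 (fun x _ => IsHub Γ x) (fun x _ => IsHub Δ x) := by
  intro s t ⟨_, f, hf⟩ i _
  obtain ⟨l, hl, -⟩ := hι i i
  have : Δ.neighborSet (t i) = f '' Γ.neighborSet (s i) := by
    ext y
    have := (hf (f.symm y) l i l).1
    simp only [Function.update_self, Function.update_of_ne hl.symm, f.apply_symm_apply] at this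
    rw [f.image_eq_preimage_symm, Set.mem_preimage, SimpleGraph.mem_neighborSet,
      SimpleGraph.mem_neighborSet, this]
  simp only [IsHub, this, Set.ncard_image_of_injective _ f.injective]

theorem detected_isC (hι : ∀ i j : ι, ∃ l, l ≠ i ∧ l ≠ j) :
    Detected ι Γ Δ 2 (fun x _ => IsC Γ x) (fun x _ => IsC Δ x) :=
  have h := detected_isHub (Γ := Γ) (Δ := Δ) hι
  (h.not.of_le (Nat.le_succ 1)).and ((Detected.adj.of_le zero_le_one).comp hι h).not

theorem detected_isA (hι : ∀ i j : ι, ∃ l, l ≠ i ∧ l ≠ j) :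
    Detected ι Γ Δ 3 (fun x _ => IsA Γ x) (fun x _ => IsA Δ x) :=
  have h := detected_isC (Γ := Γ) (Δ := Δ) hι
  ((detected_isHub hι).not.of_le (by decide)).and ((h.not.of_le (Nat.le_succ 2)).and
    ((Detected.adj.of_le zero_le_two).comp hι h).not)

theorem detected_isB (hι : ∀ i j : ι, ∃ l, l ≠ i ∧ l ≠ j) :
    Detected ι Γ Δ 4 (fun x _ => IsB Γ x) (fun x _ => IsB Δ x) :=
  ((detected_isHub hι).not.of_le (by decide)).and
    ((Detected.adj.of_le (Nat.zero_le 3)).comp hι (detected_isA hι))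

theorem detected_isD (hι : ∀ i j : ι, ∃ l, l ≠ i ∧ l ≠ j) :
    Detected ι Γ Δ 4 (fun x _ => IsD Γ x) (fun x _ => IsD Δ x) :=
  ((detected_isHub hι).not.of_le (by decide)).and (((detected_isA hι).not.of_le (by decide)).and
    ((detected_isB hι).not.and ((detected_isC hι).not.of_le (by decide))))

theorem detected_isLeft (hι : ∀ i j : ι, ∃ l, l ≠ i ∧ l ≠ j) :
    Detected ι Γ Δ 5 (IsLeft Γ) (IsLeft Δ) :=
  (Detected.adj.of_le (Nat.zero_le 4)).comp hι ((detected_isB hι).and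
    ((Detected.adj.of_le (Nat.zero_le 3)).comp hι
      ((detected_isA hι).and (Detected.adj.of_le (Nat.zero_le 3)))))

theorem detected_isRight (hι : ∀ i j : ι, ∃ l, l ≠ i ∧ l ≠ j) :
    Detected ι Γ Δ 5 (IsRight Γ) (IsRight Δ) :=
  (Detected.adj.of_le (Nat.zero_le 4)).comp hι
    ((detected_isB hι).and (Detected.adj.of_le (Nat.zero_le 4)))

theorem detected_isProd (hι : ∀ i j : ι, ∃ l, l ≠ i ∧ l ≠ j) :
    Detected ι Γ Δ 5 (IsProd Γ) (IsProd Δ) :=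
  (Detected.adj.of_le (Nat.zero_le 4)).comp hι
    ((detected_isD hι).and (Detected.adj.of_le (Nat.zero_le 4)))

end Detected

/-! ### Recovering the kinds and the multiplication from the graph -/

section Kinds

variable {G : Type*} [Group G]

theorem isHub_inl [Finite G] [Nontrivial G] (x : G) : IsHub (cayleyGraph G) (.inl x) := by
  -- Over the trivial group a group element has only three neighbors, hence the need for a second
  -- element.
  obtain ⟨y, hy⟩ := exists_ne (1 : G)
  have hsub : ({.inr ((x, 1), .a), .inr ((x, y), .a), .inr ((1, x), .b), .inr ((y, x), .b)} :
      Set (GadgetVertex G)) ⊆ (cayleyGraph G).neighborSet (.inl x) := by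
    rintro _ (rfl | rfl | rfl | rfl) <;> simp [adj_inl_inr]
  refine le_trans (le_of_eq ?_) (Set.ncard_le_ncard hsub)
  rw [Set.ncard_insert_of_notMem, Set.ncard_insert_of_notMem, Set.ncard_pair] <;>
    simp [hy.symm]

theorem not_isHub_inr (p : G × G) (κ : GadgetKind) : ¬ IsHub (cayleyGraph G) (.inr (p, κ)) := by
  have hthree (u v w : GadgetVertex G) : ({u, v, w} : Set (GadgetVertex G)).ncard < 4 :=
    Nat.lt_succ_of_le ((Set.ncard_insert_le _ _).trans
      (Nat.succ_le_succ ((Set.ncard_insert_le _ _).trans (by simp))))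
  obtain ⟨u, v, w, h⟩ : ∃ u v w : GadgetVertex G,
      (cayleyGraph G).neighborSet (.inr (p, κ)) ⊆ {u, v, w} := by
    rcases κ
    · refine ⟨.inl p.1, .inr (p, .b), .inr (p, .b), ?_⟩
      rintro (z | ⟨q, μ⟩) <;> simp +contextual [adj_inr_inl, adj_inr_inr]
    · refine ⟨.inl p.2, .inr (p, .a), .inr (p, .c), ?_⟩
      rintro (z | ⟨q, μ⟩) <;> simp +contextual [adj_inr_inl, adj_inr_inr]
      rintro rfl (rfl | rfl) <;> simp
    · refine ⟨.inr (p, .b), .inr (p, .d), .inr (p, .d), ?_⟩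
      rintro (z | ⟨q, μ⟩) <;> simp +contextual [adj_inr_inl, adj_inr_inr]
      rintro rfl (rfl | rfl) <;> simp
    · refine ⟨.inl (p.1 * p.2), .inr (p, .c), .inr (p, .c), ?_⟩
      rintro (z | ⟨q, μ⟩) <;> simp +contextual [adj_inr_inl, adj_inr_inr]
  exact not_le.2 ((Set.ncard_le_ncard h (Set.toFinite _)).trans_lt (hthree u v w))

variable [Finite G] [Nontrivial G]

theorem isHub_iff (x : GadgetVertex G) : IsHub (cayleyGraph G) x ↔ vertexKind x = none := by
  rcases x with x | ⟨p, κ⟩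
  · simp [isHub_inl, vertexKind]
  · simp [not_isHub_inr, vertexKind]

/-- Among gadget vertices only `c` is attached to no group element; of the others, only `a` is not
next to a `c`, and `b` is the one next to `a`. -/
theorem isC_iff (x : GadgetVertex G) : IsC (cayleyGraph G) x ↔ vertexKind x = some .c := by
  rcases x with x | ⟨p, _ | _ | _ | _⟩ <;>
    simp [IsC, isHub_iff, vertexKind, adj_inr_inl, adj_inl_inl]

theorem isA_iff (x : GadgetVertex G) : IsA (cayleyGraph G) x ↔ vertexKind x = some .a := by
  rcases x with x | ⟨p, _ | _ | _ | _⟩ <;>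
    simp [IsA, isHub_iff, isC_iff, vertexKind, adj_inr_inl, adj_inr_inr, adj_inl_inl, adj_inl_inr]

theorem isB_iff (x : GadgetVertex G) : IsB (cayleyGraph G) x ↔ vertexKind x = some .b := by
  rcases x with x | ⟨p, _ | _ | _ | _⟩ <;>
    simp [IsB, isHub_iff, isA_iff, vertexKind, adj_inr_inl, adj_inr_inr, adj_inl_inl, adj_inl_inr]

theorem isD_iff (x : GadgetVertex G) : IsD (cayleyGraph G) x ↔ vertexKind x = some .d := by
  rcases x with x | ⟨p, _ | _ | _ | _⟩ <;>
    simp [IsD, isHub_iff, isA_iff, isB_iff, isC_iff, vertexKind]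

theorem isLeft_iff (x y z : G) :
    IsLeft (cayleyGraph G) (.inr ((x, y), .c)) (.inl z) ↔ x = z := by
  simp [IsLeft, isA_iff, isB_iff, vertexKind, adj_inr_inr, adj_inr_inl]

theorem isRight_iff (x y z : G) :
    IsRight (cayleyGraph G) (.inr ((x, y), .c)) (.inl z) ↔ y = z := by
  simp [IsRight, isB_iff, vertexKind, adj_inr_inr, adj_inr_inl]

theorem isProd_iff (x y z : G) :
    IsProd (cayleyGraph G) (.inr ((x, y), .c)) (.inl z) ↔ x * y = z := by
  simp [IsProd, isD_iff, vertexKind, adj_inr_inr, adj_inr_inl]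

end Kinds

/-! ### Products of stored group elements -/

section Cayley

variable {ι G H : Type*} [DecidableEq ι]

/-- The vertex of kind `c` of a multiplication gadget. -/
def cVertex (q : Bool → G) : GadgetVertex G :=
  .inr ((q false, q true), .c)

theorem vertexKind_eq_none {x : GadgetVertex G} : vertexKind x = none ↔ ∃ g, x = .inl g := by
  rcases x with x | ⟨p, μ⟩ <;> simp [vertexKind]

theorem vertexKind_eq_c {x : GadgetVertex G} : vertexKind x = some .c ↔ ∃ q, x = cVertex q := by
  rcases x with x | ⟨⟨g, h⟩, μ⟩
  · simp [vertexKind, cVertex]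
  · refine ⟨fun hμ => ⟨fun a => if a then h else g, ?_⟩, fun ⟨q, hq⟩ => ?_⟩
    · simp_all [vertexKind, cVertex]
    · simp_all [vertexKind, cVertex]

/-- Each pair in `S` is read off from pebbles other than those at the positions `i₁` and `i₂`. -/
def Stored (i₁ i₂ : ι) (s : ι → GadgetVertex G) (t : ι → GadgetVertex H) (S : Set (G × H)) : Prop :=
  ∀ w ∈ S, ∃ i, i ≠ i₁ ∧ i ≠ i₂ ∧ ∃ q q' a, s i = cVertex q ∧ t i = cVertex q' ∧ w = (q a, q' a)

namespace Stored

variable {i₁ i₂ : ι} {s : ι → GadgetVertex G} {t : ι → GadgetVertex H} {S : Set (G × H)}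

theorem update_left (h : Stored i₁ i₂ s t S) (x : GadgetVertex G) (y : GadgetVertex H) :
    Stored i₁ i₂ (Function.update s i₁ x) (Function.update t i₁ y) S := by
  intro w hw
  obtain ⟨i, h₁, h₂, hi⟩ := h w hw
  exact ⟨i, h₁, h₂, by simpa [h₁] using hi⟩

theorem update_right (h : Stored i₁ i₂ s t S) (x : GadgetVertex G) (y : GadgetVertex H) :
    Stored i₁ i₂ (Function.update s i₂ x) (Function.update t i₂ y) S := by
  intro w hw
  obtain ⟨i, h₁, h₂, hi⟩ := h w hw
  exact ⟨i, h₁, h₂, by simpa [h₂] using hi⟩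

end Stored

variable [Group G] [Group H]

/-- Duplicator survives `r` rounds on `Γ_G` and `Γ_H`. -/
abbrev CayleyEquiv (r : ℕ) (s : ι → GadgetVertex G) (t : ι → GadgetVertex H) : Prop :=
  GameEquiv (GraphEquiv (cayleyGraph G) (cayleyGraph H)) r s t

namespace GameEquiv

variable [Finite G] [Nontrivial G] [Finite H] [Nontrivial H]
  {s : ι → GadgetVertex G} {t : ι → GadgetVertex H} {r : ℕ}

theorem vertexKind_eq (hι : ∀ i j : ι, ∃ l, l ≠ i ∧ l ≠ j) (hst : CayleyEquiv r s t)
    (hr : 4 ≤ r) (i : ι) : vertexKind (t i) = vertexKind (s i) := by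
  have h (μ) : vertexKind (s i) = μ ↔ vertexKind (t i) = μ := by
    rcases μ with _ | _ | _ | _ | _
    · simpa only [isHub_iff] using (detected_isHub hι).of_le (by lia) s t hst i i
    · simpa only [isA_iff] using (detected_isA hι).of_le (by lia) s t hst i i
    · simpa only [isB_iff] using (detected_isB hι).of_le (by lia) s t hst i i
    · simpa only [isC_iff] using (detected_isC hι).of_le (by lia) s t hst i i
    · simpa only [isD_iff] using (detected_isD hι).of_le (by lia) s t hst i i
  exact (h _).1 rfl

theorem exists_eq_inl (hι : ∀ i j : ι, ∃ l, l ≠ i ∧ l ≠ j) (hst : CayleyEquiv r s t)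
    (hr : 4 ≤ r) {i : ι} {x : G} (hi : s i = .inl x) : ∃ y, t i = .inl y := by
  rw [← vertexKind_eq_none, hst.vertexKind_eq hι hr, vertexKind_eq_none]
  exact ⟨x, hi⟩

theorem exists_eq_cVertex (hι : ∀ i j : ι, ∃ l, l ≠ i ∧ l ≠ j) (hst : CayleyEquiv r s t)
    (hr : 4 ≤ r) {i : ι} {q : Bool → G} (hi : s i = cVertex q) : ∃ q', t i = cVertex q' := by
  rw [← vertexKind_eq_c, hst.vertexKind_eq hι hr, vertexKind_eq_c]
  exact ⟨q, hi⟩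

theorem factor_eq_iff (hι : ∀ i j : ι, ∃ l, l ≠ i ∧ l ≠ j) (hst : CayleyEquiv r s t)
    (hr : 5 ≤ r) {i j : ι} {q : Bool → G} {q' : Bool → H} {x : G} {y : H}
    (hi : s i = cVertex q) (hi' : t i = cVertex q') (hj : s j = .inl x) (hj' : t j = .inl y)
    (a : Bool) : q a = x ↔ q' a = y := by
  cases a
  · simpa only [hi, hi', hj, hj', cVertex, isLeft_iff] using
      (detected_isLeft hι).of_le hr s t hst i j
  · simpa only [hi, hi', hj, hj', cVertex, isRight_iff] using
      (detected_isRight hι).of_le hr s t hst i j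

theorem mul_eq_iff (hι : ∀ i j : ι, ∃ l, l ≠ i ∧ l ≠ j) (hst : CayleyEquiv r s t)
    (hr : 5 ≤ r) {i j : ι} {q : Bool → G} {q' : Bool → H} {x : G} {y : H}
    (hi : s i = cVertex q) (hi' : t i = cVertex q') (hj : s j = .inl x) (hj' : t j = .inl y) :
    q false * q true = x ↔ q' false * q' true = y := by
  simpa only [hi, hi', hj, hj', cVertex, isProd_iff] using
    (detected_isProd hι).of_le hr s t hst i j

/-- Spoiler puts the common factor itself on a third pebble and compares it with both gadgets. -/
theorem factor_eq_factor (hι : ∀ i j : ι, ∃ l, l ≠ i ∧ l ≠ j) (hst : CayleyEquiv r s t)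
    (hr : 6 ≤ r) {i j : ι} {p q : Bool → G} {p' q' : Bool → H}
    (hi : s i = cVertex p) (hi' : t i = cVertex p') (hj : s j = cVertex q)
    (hj' : t j = cVertex q') {a : Bool} (h : p a = q a) : p' a = q' a := by
  obtain ⟨-, f, hf⟩ := hst.of_le hr
  obtain ⟨l, hli, hlj⟩ := hι i j
  have hfl := hf (.inl (p a)) l
  obtain ⟨y, hy⟩ := hfl.exists_eq_inl hι (by lia) (Function.update_self ..)
  have h₁ := (hfl.factor_eq_iff hι le_rfl (i := i) (q := p) (q' := p') (by simpa [hli.symm])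
    (by simpa [hli.symm]) (Function.update_self ..) hy a).1 rfl
  have h₂ := (hfl.factor_eq_iff hι le_rfl (i := j) (q := q) (q' := q') (by simpa [hlj.symm])
    (by simpa [hlj.symm]) (Function.update_self ..) hy a).1 h.symm
  rw [h₁, h₂]

/-- The answer to the gadget `M(1, 1)` has both factors and the product equal to `y`, so `y * y =
y`. -/
theorem eq_one (hι : ∀ i j : ι, ∃ l, l ≠ i ∧ l ≠ j) (hst : CayleyEquiv r s t)
    (hr : 6 ≤ r) {i : ι} {y : H} (hi : s i = .inl 1) (hi' : t i = .inl y) : y = 1 := by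
  obtain ⟨-, f, hf⟩ := hst.of_le hr
  obtain ⟨l, hli, -⟩ := hι i i
  have hfl := hf (cVertex 1) l
  obtain ⟨q, hq⟩ := hfl.exists_eq_cVertex hι (by lia) (Function.update_self ..)
  have hs : Function.update s l (cVertex 1) i = .inl 1 := by simpa [hli.symm]
  have ht : Function.update t l (f (cVertex 1)) i = .inl y := by simpa [hli.symm]
  have h₁ (a) := (hfl.factor_eq_iff hι le_rfl (Function.update_self ..) hq hs ht a).1 rfl
  have h₂ := (hfl.mul_eq_iff hι le_rfl (Function.update_self ..) hq hs ht).1 (mul_one 1)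
  rwa [h₁, h₁, mul_eq_left] at h₂

end GameEquiv

namespace Stored

variable {i₁ i₂ : ι} {s : ι → GadgetVertex G} {t : ι → GadgetVertex H} {S : Set (G × H)}
  [Finite G] [Nontrivial G] [Finite H] [Nontrivial H]

open scoped Pointwise in
/-- Products of at most `2 ^ j` stored pairs are respected as long as Duplicator survives. -/
theorem eq_of_mem_pow (hι : ∀ i j : ι, ∃ l, l ≠ i ∧ l ≠ j) (h₁₂ : i₁ ≠ i₂) (j : ℕ)
    (hS : Stored i₁ i₂ s t S) (hst : CayleyEquiv (2 * j + 6) s t) {x : G} {y z : H}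
    (hx : s i₁ = .inl x) (hy : t i₁ = .inl y) (hxz : (x, z) ∈ insert 1 S ^ 2 ^ j) : y = z := by
  induction j generalizing s t x y z with
  | zero =>
    rw [pow_zero, pow_one] at hxz
    obtain h | h := hxz
    · obtain ⟨rfl, rfl⟩ := Prod.mk.inj h
      exact hst.eq_one hι (by lia) hx hy
    · obtain ⟨i, -, -, q, q', a, hq, hq', hw⟩ := hS _ h
      obtain ⟨rfl, rfl⟩ := Prod.mk.inj hw
      exact ((hst.factor_eq_iff hι (by lia) hq hq' hx hy a).1 rfl).symm
  | succ j ih =>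
    rw [pow_succ, mul_two, pow_add] at hxz
    obtain ⟨⟨x₁, z₁⟩, hz₁, ⟨x₂, z₂⟩, hz₂, hxz⟩ := hxz
    obtain ⟨rfl, rfl⟩ := Prod.mk.inj hxz
    obtain ⟨-, f, hf⟩ := hst
    -- Halving: the gadget of the two half-length products goes on `i₂`, then either half replaces
    -- the pebble on `i₁`. The induction may reuse `i₂`, since no stored pair relies on it. Each
    -- halving costs two rounds.
    let q (a : Bool) : G := if a then x₂ else x₁
    have hfq := hf (cVertex q) i₂
    obtain ⟨q', hq'⟩ := hfq.exists_eq_cVertex hι (by lia) (Function.update_self ..)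
    have hprod := (hfq.mul_eq_iff hι (by lia) (Function.update_self ..) hq'
      ((Function.update_of_ne h₁₂ _ _).trans hx) ((Function.update_of_ne h₁₂ _ _).trans hy)).1 rfl
    have key (a : Bool) {v : H} (hv : (q a, v) ∈ insert 1 S ^ 2 ^ j) : q' a = v := by
      have hS' := hS.update_right (cVertex q) (f (cVertex q))
      obtain ⟨-, f', hf'⟩ := hfq
      have hfa := hf' (.inl (q a)) i₁
      obtain ⟨w, hw⟩ := hfa.exists_eq_inl hι (by lia) (Function.update_self ..)
      rw [← ih (hS'.update_left _ _) hfa (Function.update_self ..) hw hv]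
      exact (hfa.factor_eq_iff hι (by lia) (i := i₂) (q := q) (by simp [h₁₂.symm])
        (by simpa [h₁₂.symm] using hq') (Function.update_self ..) hw a).1 rfl
    rw [← hprod, key false hz₁, key true hz₂]

/-- Since `1` is adjoined, every element of the closure is a product of `2 ^ j` elements of `insert
1 S`. Duplicator's bijection hence sends `w.1` to `w.2` throughout the closure, and in particular
`1` to `1`; its injectivity gives the claim. -/
theorem fst_eq_one_iff (hι : ∀ i j : ι, ∃ l, l ≠ i ∧ l ≠ j) (h₁₂ : i₁ ≠ i₂) {j : ℕ}
    (hj : Nat.card (G × H) ≤ 2 ^ j) (hS : Stored i₁ i₂ s t S)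
    (hst : CayleyEquiv (2 * j + 7) s t) {w : G × H} (hw : w ∈ Subgroup.closure S) :
    w.1 = 1 ↔ w.2 = 1 := by
  open scoped Pointwise in
  have := Fintype.ofFinite (G × H)
  have hne : (insert 1 S).Nonempty := ⟨1, Set.mem_insert _ _⟩
  have hle : Subgroup.closure S ≤ powCardSubgroup (insert 1 S) hne := by
    rw [Subgroup.closure_le]
    intro v hv
    have : insert 1 S ^ 1 ⊆ insert 1 S ^ Fintype.card (G × H) :=
      Set.pow_subset_pow_right (Set.mem_insert _ _) Fintype.card_pos
    exact this (by simpa using Or.inr hv)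
  have hmem (v) (hv : v ∈ Subgroup.closure S) : v ∈ insert 1 S ^ 2 ^ j :=
    Set.pow_subset_pow_right (Set.mem_insert _ _) (by rwa [← Nat.card_eq_fintype_card]) (hle hv)
  obtain ⟨-, f, hf⟩ := hst
  have hfv (v) (hv : v ∈ Subgroup.closure S) : f (.inl v.1) = .inl v.2 := by
    obtain ⟨y, hy⟩ := (hf (.inl v.1) i₁).exists_eq_inl hι (by lia) (Function.update_self ..)
    have := eq_of_mem_pow hι h₁₂ j (hS.update_left _ _) (hf (.inl v.1) i₁)
      (Function.update_self ..) hy (hmem v hv)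
    rwa [this, Function.update_self] at hy
  have h₁ := hfv 1 (one_mem _)
  have hw' := hfv w hw
  rw [← Sum.inl_injective.eq_iff, ← f.injective.eq_iff, hw', ← Prod.fst_one (M := G) (N := H), h₁,
    Sum.inl_injective.eq_iff, Prod.snd_one]

end Stored

end Cayley

/-! ### Marked isomorphism -/

section TupleIso

variable {ι G H : Type*} [Group G] [Group H] {g : ι → G} {h : ι → H}

/-- The same products of the `gᵢ` and of the `hᵢ` are trivial. -/
def TupleIso (g : ι → G) (h : ι → H) : Prop :=
  ∀ w ∈ Subgroup.closure (Set.range fun i => (g i, h i)), w.1 = 1 ↔ w.2 = 1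

theorem TupleIso.comp {κ : Type*} (hgh : TupleIso g h) (e : κ → ι) :
    TupleIso (g ∘ e) (h ∘ e) :=
  fun w hw => hgh w (Subgroup.closure_mono (Set.range_comp_subset_range e _) hw)

theorem TupleIso.of_mulEquiv (φ : G ≃* H) (g : ι → G) : TupleIso g (φ ∘ g) := by
  intro w hw
  have : φ w.1 = w.2 := by
    induction hw using Subgroup.closure_induction with
    | mem w hw => obtain ⟨i, rfl⟩ := hw; rfl
    | one => simp
    | mul v w _ _ hv hw => simp [hv, hw]
    | inv v _ hv => simp [hv]
  rw [← this, map_eq_one_iff φ φ.injective]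

/-- The subgroup of `G × H` generated by the pairs has injective projections, so it is the graph of
the isomorphism. -/
theorem TupleIso.exists_mulEquiv (hgh : TupleIso g h) :
    ∃ φ : Subgroup.closure (Set.range g) ≃* Subgroup.closure (Set.range h),
      ∀ i, φ ⟨g i, Subgroup.subset_closure ⟨i, rfl⟩⟩ =
        ⟨h i, Subgroup.subset_closure ⟨i, rfl⟩⟩ := by
  set K := Subgroup.closure (Set.range fun i => (g i, h i)) with hK
  have hg : K.map (MonoidHom.fst G H) = Subgroup.closure (Set.range g) := by
    rw [hK, MonoidHom.map_closure, ← Set.range_comp]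
    rfl
  have hh : K.map (MonoidHom.snd G H) = Subgroup.closure (Set.range h) := by
    rw [hK, MonoidHom.map_closure, ← Set.range_comp]
    rfl
  have hinj₁ : Function.Injective ((MonoidHom.fst G H).subgroupMap K) := by
    refine (injective_iff_map_eq_one _).2 fun w hw => ?_
    have h₁ : w.1.1 = 1 := congrArg Subtype.val hw
    exact Subtype.ext (Prod.ext h₁ ((hgh w.1 w.2).1 h₁))
  have hinj₂ : Function.Injective ((MonoidHom.snd G H).subgroupMap K) := by
    refine (injective_iff_map_eq_one _).2 fun w hw => ?_
    have h₂ : w.1.2 = 1 := congrArg Subtype.val hw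
    exact Subtype.ext (Prod.ext ((hgh w.1 w.2).2 h₂) h₂)
  let φ := (MulEquiv.ofBijective _ ⟨hinj₁, MonoidHom.subgroupMap_surjective _ _⟩).trans
    (MulEquiv.subgroupCongr hg)
  let ψ := (MulEquiv.ofBijective _ ⟨hinj₂, MonoidHom.subgroupMap_surjective _ _⟩).trans
    (MulEquiv.subgroupCongr hh)
  refine ⟨φ.symm.trans ψ, fun i => ?_⟩
  let k : K := ⟨(g i, h i), Subgroup.subset_closure ⟨i, rfl⟩⟩
  have : φ k = ⟨g i, Subgroup.subset_closure ⟨i, rfl⟩⟩ := rfl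
  rw [← this, MulEquiv.trans_apply, MulEquiv.symm_apply_apply]
  rfl

theorem TupleIso.nonempty_mulEquiv [Finite H] (hgh : TupleIso g h)
    (hg : Subgroup.closure (Set.range g) = ⊤) (hGH : Nat.card G = Nat.card H) :
    Nonempty (G ≃* H) := by
  obtain ⟨φ, -⟩ := hgh.exists_mulEquiv
  have hh : Subgroup.closure (Set.range h) = ⊤ := by
    rw [← Subgroup.card_eq_iff_eq_top, ← Nat.card_congr φ.toEquiv, hg, ← hGH, Subgroup.card_top]
  exact ⟨(Subgroup.topEquiv.symm.trans (MulEquiv.subgroupCongr hg.symm)).trans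
    (φ.trans ((MulEquiv.subgroupCongr hh).trans Subgroup.topEquiv))⟩

end TupleIso

/-- By Lagrange, a generator outside the subgroup generated so far at least doubles its order, so a
largest admissible `X` generates. -/
theorem exists_generating_finset (G : Type*) [Group G] [Finite G] :
    ∃ X : Finset G, Subgroup.closure (X : Set G) = ⊤ ∧ 2 ^ X.card ≤ Nat.card G := by
  classical
  have := Fintype.ofFinite G
  obtain ⟨X, hX, hmax⟩ := Finset.exists_max_image
    {X : Finset G | 2 ^ X.card ≤ Nat.card (Subgroup.closure (X : Set G))} Finset.card
    ⟨∅, by simp⟩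
  simp only [Finset.mem_filter, Finset.mem_univ, true_and] at hX hmax
  refine ⟨X, ?_, hX.trans (Subgroup.card_le_card_group _)⟩
  by_contra hne
  obtain ⟨x, hx⟩ : ∃ x, x ∉ Subgroup.closure (X : Set G) := by
    simpa [Subgroup.eq_top_iff'] using hne
  have hxX : x ∉ X := fun h => hx (Subgroup.subset_closure h)
  have hle : Subgroup.closure (X : Set G) ≤ Subgroup.closure (insert x X : Finset G) :=
    Subgroup.closure_mono (by simp)
  obtain ⟨m, hm⟩ := Subgroup.card_dvd_of_le hle
  have hlt : Subgroup.closure (X : Set G) ≠ Subgroup.closure (insert x X : Finset G) :=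
    fun h => hx (h ▸ Subgroup.subset_closure (by simp))
  have hm2 : 2 ≤ m := by
    have hpos : 0 < Nat.card (Subgroup.closure ((insert x X : Finset G) : Set G)) := Nat.card_pos
    by_contra hlt2
    interval_cases m
    · lia
    · exact hlt (Subgroup.eq_of_le_of_card_ge hle (by lia))
  have := hmax (insert x X) (by
    rw [Finset.card_insert_of_notMem hxX, hm, pow_succ]
    exact Nat.mul_le_mul hX hm2)
  rw [Finset.card_insert_of_notMem hxX] at this
  lia

/-! ### Version II is simulated by Version III -/

section Simulation

variable {κ G H : Type*}

theorem exists_ne_ne_of_sum_bool [Nonempty κ] (i j : κ ⊕ Bool) : ∃ l, l ≠ i ∧ l ≠ j := by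
  obtain ⟨b⟩ := ‹Nonempty κ›
  by_contra! h
  have h₁ := h (.inl b)
  have h₂ := h (.inr false)
  have h₃ := h (.inr true)
  grind

variable [DecidableEq κ] [Group G] [Group H] [Finite G] [Nontrivial G] [Finite H] [Nontrivial H]

/-- With pairs of group elements stored in the vertices of kind `c` and two spare pebbles, two
rounds of Version III simulate one round of Version II. -/
theorem gameEquiv_tupleIso [Nonempty κ] (hGH : Nat.card G = Nat.card H) {j : ℕ}
    (hj : Nat.card (G × H) ≤ 2 ^ j) {r : ℕ} {s : κ ⊕ Bool → GadgetVertex G}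
    {t : κ ⊕ Bool → GadgetVertex H} {u : κ × Bool → G} {v : κ × Bool → H}
    (hst : CayleyEquiv (2 * r + (2 * j + 7)) s t)
    (hs : ∀ b, s (.inl b) = cVertex fun a => u (b, a))
    (ht : ∀ b, t (.inl b) = cVertex fun a => v (b, a)) :
    GameEquiv TupleIso r u v := by
  have hι := exists_ne_ne_of_sum_bool (κ := κ)
  induction r generalizing s t u v with
  | zero =>
    intro w hw
    refine Stored.fst_eq_one_iff (i₁ := .inr false) (i₂ := .inr true) hι (by simp) hj ?_
      (hst.of_le (by lia)) hw
    rintro _ ⟨⟨b, a⟩, rfl⟩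
    exact ⟨.inl b, by simp, by simp, _, _, a, hs b, ht b, rfl⟩
  | succ r ih =>
    refine ⟨ih (hst.of_le (by lia)) hs ht, ?_⟩
    obtain ⟨-, f, hf⟩ := hst.of_le (q := 2 * r + (2 * j + 7) + 1 + 1) (by lia)
    have hF (x : G) : ∃ y, f (.inl x) = .inl y := by
      obtain ⟨y, hy⟩ := (hf (.inl x) (.inr false)).exists_eq_inl hι (by lia)
        (Function.update_self ..)
      exact ⟨y, by simpa using hy⟩
    choose F hF using hF
    have hFinj : Function.Injective F := fun x y hxy =>
      Sum.inl_injective (f.injective (by rw [hF, hF, hxy]))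
    refine ⟨Equiv.ofBijective F ((Nat.bijective_iff_injective_and_card F).2 ⟨hFinj, hGH⟩), ?_⟩
    rintro x ⟨b, a⟩
    rw [Equiv.ofBijective_apply]
    have hfx := hf (.inl x) (.inr false)
    obtain ⟨-, f', hf'⟩ := hfx
    -- With `x` on one spare pebble, the gadget of the updated pair goes on the other. Its new
    -- factor is checked against `x`, its unchanged factor against the old gadget at `.inl b`.
    have hfq := hf' (cVertex fun a' => Function.update u (b, a) x (b, a')) (.inr true)
    obtain ⟨q, hq⟩ := hfq.exists_eq_cVertex hι (by lia) (Function.update_self ..)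
    have hqv : q = fun a' => Function.update v (b, a) (F x) (b, a') := by
      funext a'
      by_cases ha : a' = a
      · subst ha
        rw [Function.update_self]
        exact (hfq.factor_eq_iff hι (by lia) (j := .inr false) (x := x) (Function.update_self ..)
          hq (by simp) (by simp [hF]) a').1 (by simp)
      · rw [Function.update_of_ne (by simpa using ha)]
        exact (hfq.factor_eq_factor hι (by lia) (i := .inl b) (p := fun a => u (b, a))
          (p' := fun a => v (b, a)) (by simp [hs]) (by simp [ht]) (Function.update_self ..) hq
          (a := a') (by simp [ha])).symm
    -- The new gadget takes over as storage for `b`, and the old one becomes a spare pebble.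
    have hsw := hfq.comp_injective
      (S' := GraphEquiv (cayleyGraph G) (cayleyGraph H)) (Equiv.swap (.inl b) (.inr true))
      (Equiv.injective _) fun s t h _ _ => h _ _
    refine ih hsw (fun b' => ?_) fun b' => ?_
    · by_cases hb : b' = b
      · subst hb
        simp
      · simp [Equiv.swap_apply_of_ne_of_ne, hb, hs]
    · by_cases hb : b' = b
      · subst hb
        rw [Function.comp_apply, Equiv.swap_apply_left, hq, hqv]
      · simp [Equiv.swap_apply_of_ne_of_ne, hb, ht]

end Simulation

/-! ### From one surviving position to all tuples -/

theorem TupleIso.markedIso {k : ℕ} {G H : Type u} [Group G] [Group H] {g : Fin k → G}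
    {h : Fin k → H} (hgh : TupleIso g h) : MarkedIso g h :=
  hgh.exists_mulEquiv

theorem not_distinguishesII_of_mulEquiv {k r : ℕ} {G H : Type u} [Group G] [Fintype G] [Group H]
    [Fintype H] (φ : G ≃* H) : ¬ DistinguishesII k r G H := by
  refine not_not.2 (map_univ_eq_of_equiv (Equiv.arrowCongr (Equiv.refl _) φ.toEquiv) fun g => ?_)
  rw [coloring_eq_iff]
  induction r generalizing g with
  | zero => exact initII_eq_iff.2 (TupleIso.of_mulEquiv φ g).markedIso
  | succ r ih =>
    refine ⟨ih g, φ.toEquiv, fun x i => ?_⟩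
    convert ih (Function.update g i x) using 1
    exact (Function.comp_update φ g i x).symm

theorem not_distinguishesII_of_cayleyEquiv {p k r : ℕ} {G H : Type u} [Group G] [Fintype G]
    [Group H] [Fintype H] (hGH : Fintype.card G = Fintype.card H) (hp : 0 < p) (hpk : p ≤ k)
    (hkp : k ≤ 2 * p) {s : Fin p ⊕ Bool → GadgetVertex G} {t : Fin p ⊕ Bool → GadgetVertex H}
    (hst : CayleyEquiv (3 * r + 18 * Nat.log 2 (Fintype.card G)) s t) :
    ¬ DistinguishesII k r G H := by
  classical
  have hcard : Nat.card G = Nat.card H := by simpa using hGH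
  rcases subsingleton_or_nontrivial G with hG | hG
  · have : Subsingleton H := by
      rw [← Finite.card_le_one_iff_subsingleton, ← hcard, Finite.card_le_one_iff_subsingleton]
      exact hG
    have := uniqueOfSubsingleton (1 : G)
    have := uniqueOfSubsingleton (1 : H)
    exact not_distinguishesII_of_mulEquiv MulEquiv.ofUnique
  have hH : Nontrivial H := by
    rwa [← Finite.one_lt_card_iff_nontrivial, ← hcard, Finite.one_lt_card_iff_nontrivial]
  have : Nonempty (Fin p) := ⟨⟨0, hp⟩⟩
  have hι := exists_ne_ne_of_sum_bool (κ := Fin p)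
  set n := Fintype.card G with hn
  set ℓ := Nat.log 2 n with hℓ
  have hℓ1 : 1 ≤ ℓ := Nat.log_pos one_lt_two Fintype.one_lt_card
  -- Both orders are below `2 ^ (ℓ + 1)`, which fixes the number of halvings at `2 * ℓ + 2`.
  have hj : Nat.card (G × H) ≤ 2 ^ (2 * ℓ + 2) := by
    have : n ≤ 2 ^ (ℓ + 1) := (Nat.lt_pow_succ_log_self one_lt_two n).le
    rw [Nat.card_prod, Nat.card_eq_fintype_card, Nat.card_eq_fintype_card, ← hGH,
      show 2 * ℓ + 2 = (ℓ + 1) + (ℓ + 1) by ring, pow_add]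
    exact Nat.mul_le_mul this this
  -- If `k ≤ ℓ`, the cost is `2(r + k) + (4ℓ + 11) + p`, at most `3r + 18ℓ` because `p ≤ k ≤ ℓ` and
  -- `1 ≤ ℓ`. If `k > ℓ`, then `ℓ < 2 * p`, so a generating set of at most `ℓ` elements fits on the
  -- storage pebbles.
  rcases le_or_gt k ℓ with hkℓ | hkℓ
  · obtain ⟨t', ht'⟩ := GameEquiv.exists_piecewise (fun _ => cVertex 1)
      (Finset.univ.image Sum.inl)
      (hst.of_le (q := 2 * (r + k) + (2 * (2 * ℓ + 2) + 7) +
        (Finset.univ.image (Sum.inl : Fin p → Fin p ⊕ Bool)).card) (by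
          rw [Finset.card_image_of_injective _ Sum.inl_injective, Finset.card_univ,
            Fintype.card_fin]
          lia))
    have hone (b : Fin p) : (Finset.univ.image Sum.inl).piecewise (fun _ => cVertex 1) s (.inl b) =
        cVertex (1 : Bool → G) := by simp
    choose v hv using fun b => ht'.exists_eq_cVertex hι (by lia) (hone b)
    have hgame := gameEquiv_tupleIso (u := 1) (v := fun ba => v ba.1 ba.2) hcard hj ht' hone hv
    have hle : Fintype.card (Fin k) ≤ Fintype.card (Fin p × Bool) := by simp; lia
    obtain ⟨e⟩ := Function.Embedding.nonempty_of_card_le hle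
    have := hgame.comp_injective (S' := fun s t => initII G k s = initII H k t) e e.injective
      fun s t h => initII_eq_iff.2 (h.comp e).markedIso
    exact not_not.2 (valueMultiset_coloring_eq_of_gameEquiv hGH this)
  · obtain ⟨X, hX, hXcard⟩ := exists_generating_finset G
    have hXℓ : X.card ≤ ℓ :=
      Nat.le_log_of_pow_le one_lt_two (by rwa [Nat.card_eq_fintype_card] at hXcard)
    have hle : Fintype.card X ≤ Fintype.card (Fin p × Bool) := by simp; lia
    obtain ⟨e⟩ := Function.Embedding.nonempty_of_card_le hle
    let u : Fin p × Bool → G := Function.extend e Subtype.val 1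
    have hu (x : X) : u (e x) = x := e.injective.extend_apply _ _ x
    let B : Finset (Fin p ⊕ Bool) := Finset.univ.image fun x => .inl (e x).1
    have hB : B.card ≤ ℓ := Finset.card_image_le.trans (by simpa using hXℓ)
    obtain ⟨t', ht'⟩ := GameEquiv.exists_piecewise
      (Sum.elim (fun b => cVertex fun a => u (b, a)) fun _ => cVertex 1) B
      (hst.of_le (q := 2 * (2 * ℓ + 2) + 7 + B.card) (by lia))
    have hpos (x : X) : B.piecewise (Sum.elim (fun b => cVertex fun a => u (b, a))
        fun _ => cVertex 1) s (.inl (e x).1) = cVertex fun a => u ((e x).1, a) := by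
      rw [Finset.piecewise_eq_of_mem _ _ _ (Finset.mem_image_of_mem _ (Finset.mem_univ x))]
      rfl
    choose v hv using fun x => ht'.exists_eq_cVertex hι (by lia) (hpos x)
    have hiso : TupleIso (fun x : X => (x : G)) fun x => v x (e x).2 := by
      intro w hw
      refine Stored.fst_eq_one_iff (i₁ := .inr false) (i₂ := .inr true) hι (by simp) hj ?_ ht' hw
      rintro _ ⟨x, rfl⟩
      exact ⟨.inl (e x).1, by simp, by simp, _, _, (e x).2, hpos x, hv x, by simp [hu]⟩
    obtain ⟨φ⟩ := hiso.nonempty_mulEquiv (by simpa using hX) hcard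
    exact not_distinguishesII_of_mulEquiv φ

/-- A single pair of equally colored tuples already contradicts `h`, so both senses follow alike. -/
theorem distinguishesIII_of_distinguishesII {p k r : ℕ} {G H : Type u} [Group G] [Fintype G]
    [Group H] [Fintype H] (hGH : Fintype.card G = Fintype.card H) (hp : 0 < p) (hpk : p ≤ k)
    (hkp : k ≤ 2 * p) (h : DistinguishesII k r G H) :
    DistinguishesIII (p + 2) (3 * r + 18 * Nat.log 2 (Fintype.card G)) G H ∧
      DistinguishesIIIPullback (p + 2) (3 * r + 18 * Nat.log 2 (Fintype.card G)) G H := by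
  let e : Fin p ⊕ Bool ≃ Fin (p + 2) := Fintype.equivFinOfCardEq (by simp)
  have key {s : Fin (p + 2) → GadgetVertex G} {t : Fin (p + 2) → GadgetVertex H}
      (hst : coloringIII G (p + 2) (3 * r + 18 * Nat.log 2 (Fintype.card G)) s =
        coloringIII H (p + 2) (3 * r + 18 * Nat.log 2 (Fintype.card G)) t) : False := by
    refine not_distinguishesII_of_cayleyEquiv hGH hp hpk hkp ?_ h (s := s ∘ e) (t := t ∘ e)
    exact (coloring_eq_iff.1 hst).comp_injective e e.injective
      fun s t h _ _ => initGraph_eq_iff.1 h _ _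
  constructor
  · intro h'
    obtain ⟨E, hE⟩ := exists_equiv_of_map_univ_eq h'
    exact key (hE fun _ => .inl 1)
  · intro h'
    obtain ⟨E, hE⟩ := exists_equiv_of_map_univ_eq h'
    exact key (hE fun _ => 1)

end WLGroups

theorem mainTheorem8 :
    ∃ C : ℕ, ∀ (G H : Type u) [Group G] [Fintype G] [Group H] [Fintype H] (n : ℕ),
      Fintype.card G = n → Fintype.card H = n →
      ∀ k r : ℕ, 2 ≤ k → 1 ≤ r →
        (WLGroups.DistinguishesI k r G H → WLGroups.DistinguishesII k r G H) ∧
        (WLGroups.DistinguishesII k r G H →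
          WLGroups.DistinguishesIII (⌈(k : ℚ) / 2⌉₊ + 2) (3 * r + C * Nat.log 2 n) G H ∧
          WLGroups.DistinguishesIIIPullback (⌈(k : ℚ) / 2⌉₊ + 2) (3 * r + C * Nat.log 2 n) G H) ∧
        (WLGroups.DistinguishesIII k r G H ∨ WLGroups.DistinguishesIIIPullback k r G H →
          WLGroups.DistinguishesI (2 * k + 1) (2 * r) G H) := by
  refine ⟨18, fun G H _ _ _ _ n hG hH k r hk _ => ⟨fun h => h.distinguishesII, fun h => ?_,
    fun h => ?_⟩⟩
  · have hk0 : (2 : ℚ) ≤ k := by exact_mod_cast hk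
    subst hG
    refine WLGroups.distinguishesIII_of_distinguishesII hH.symm (Nat.ceil_pos.2 (by linarith))
      (Nat.ceil_le.2 (by linarith)) ?_ h
    have := Nat.le_ceil ((k : ℚ) / 2)
    have : (k : ℚ) ≤ 2 * ⌈(k : ℚ) / 2⌉₊ := by linarith
    exact_mod_cast this
  · by_contra hI
    obtain ⟨h₁, h₂⟩ := WLGroups.not_distinguishesIII_of_not_distinguishesI (hG.trans hH.symm) hk hI
    exact h.elim h₁ h₂
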